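/- Consider a ring of $N\ge 1$ processors, numbered cyclically modulo $N$, each of which holds at most one token. Herman's algorithm proceeds in discrete time: at every step, simultaneously, each processor holding a token either keeps it or passes it to the next processor in the ring, each with probability $\tfrac12$, independently of the other processors and of the earlier steps; if a processor keeps its token and also receives one from the previous processor, the two tokens annihilate each other. The time to stabilisation is the first time $T\in\{0,1,2,\dots\}\cup\{\infty\}$ at which exactly one token is left. Then, for every start configuration with an odd number of tokens, \[ \mathbb{E}(T) < \frac{(\pi^2-8)\,N^2}{12}. \] -/

import Mathlib

open MeasureTheory
open scoped ENNReal

/-- One synchronous step of Herman's algorithm on the ring of processors `Fin N` (addition is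
modulo `N`). `A` is the set of processors that hold a token; `c i = true` means that processor `i`
passes its token (if it has one) to the next processor `i + 1`, and `c i = false` that it keeps it.
A processor that both keeps a token and receives one ends up without a token, hence the
symmetric difference of the kept and of the passed tokens. -/
def hermanStep {N : ℕ} [NeZero N] (c : Fin N → Bool) (A : Finset (Fin N)) : Finset (Fin N) :=
  symmDiff (A.filter fun i => c i = false) ((A.filter fun i => c i = true).image fun i => i + 1)

/-- The configuration after `t` steps from the start configuration `A`, where `ω t i` is the coin
of processor `i` at time `t`. -/
def hermanRun {N : ℕ} [NeZero N] (A : Finset (Fin N)) (ω : ℕ → Fin N → Bool) :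
    ℕ → Finset (Fin N)
  | 0 => A
  | t + 1 => hermanStep (ω t) (hermanRun A ω t)

/-- The time to stabilisation: the first time at which exactly one token is left
(`⊤` if this never happens). -/
noncomputable def stabilisationTime {N : ℕ} [NeZero N] (A : Finset (Fin N))
    (ω : ℕ → Fin N → Bool) : ℕ∞ :=
  ⨅ (t : ℕ) (_ : (hermanRun A ω t).card = 1), (t : ℕ∞)

/-- The law of all the coins: independent over times and processors, each coin being fair. -/
noncomputable def hermanCoins (N : ℕ) : Measure (ℕ → Fin N → Bool) :=
  Measure.infinitePi fun _ : ℕ => Measure.pi fun _ : Fin N => (PMF.uniformOfFintype Bool).toMeasure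

/-- The expected time to stabilisation from the start configuration `A`, in `[0, ∞]`. -/
noncomputable def expectedStabilisationTime {N : ℕ} [NeZero N] (A : Finset (Fin N)) : ℝ≥0∞ :=
  ∫⁻ ω, (stabilisationTime A ω : ℝ≥0∞) ∂(hermanCoins N)

/-! Read a configuration as the sequence `s` of parities of the tokens met along the ring. Since the
number `m = 2k + 1` of tokens is odd, `s` changes sign after each lap. A step replaces every sign by
itself or its predecessor, with independent fair coins, up to a global sign. The sum `E` of the
squared window sums ignores that sign, and a mean-variance computation shows that it grows on
average by `N (m - 1)` (`coinMean_windowEnergy_hermanStep`). So `φ = (N² + 2)/6 - E/(2N)` loses `k`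
on average and vanishes at one token.

The geometric input is `windowEnergy_ge`, a calibration argument, which gives `φ ≤ B k = N²/6 (1 -
1/(2k+1)²)`. The time potential divides `φ` by the current `k` and adds `B i / (i (i + 1))` for `i <
k`, which pays for the growth of the weight `1/k` whenever `k` drops. It therefore loses at least
`1` per step on average (`coinMean_timePotential_le`) and bounds the expected time. As `B i / (i (i
+ 1)) = N²/6 · 4/(2i+1)²` for `i ≥ 1`, the bound is a partial sum of the series of odd inverse
squares plus a remainder, strictly below its limit `(π² - 8) N²/12`. -/

/-! ### Antiperiodic sequences of signs -/

/-- The sum of `s` over the window of length `N` that starts at `j`. -/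
def windowSum (N : ℕ) (s : ℕ → ℝ) (j : ℕ) : ℝ := ∑ d ∈ Finset.range N, s (j + d)

/-- The sum of the squares of the window sums over one period. -/
def windowEnergy (N : ℕ) (s : ℕ → ℝ) : ℝ := ∑ j ∈ Finset.range N, windowSum N s j ^ 2

theorem sum_range_add_of_periodic {N : ℕ} {f : ℕ → ℝ} (hf : ∀ j, f (j + N) = f j) (p : ℕ) :
    ∑ j ∈ Finset.range N, f (j + p) = ∑ j ∈ Finset.range N, f j := by
  induction p with
  | zero => simp
  | succ p ih =>
    have h := Finset.sum_range_succ (fun j => f (j + p)) N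
    rw [Finset.sum_range_succ', add_comm N p, hf p] at h
    rw [← ih]
    simp only [zero_add] at h
    have h' := add_right_cancel h
    rw [← h']
    exact Finset.sum_congr rfl fun j _ => by congr 1; ring

theorem windowSum_succ_sub {N : ℕ} {s : ℕ → ℝ} (hs : ∀ j, s (j + N) = -s j) (j : ℕ) :
    windowSum N s (j + 1) - windowSum N s j = -2 * s j := by
  have h := Finset.sum_range_succ (fun d => s (j + d)) N
  rw [Finset.sum_range_succ', hs] at h
  have h' : windowSum N s (j + 1) = ∑ d ∈ Finset.range N, s (j + (d + 1)) :=
    Finset.sum_congr rfl fun d _ => by congr 1; ring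
  rw [h', windowSum]
  simp only [add_zero] at h
  linarith

theorem windowSum_add_period {N : ℕ} {s : ℕ → ℝ} (hs : ∀ j, s (j + N) = -s j) (j : ℕ) :
    windowSum N s (j + N) = -windowSum N s j := by
  rw [windowSum, windowSum, ← Finset.sum_neg_distrib]
  exact Finset.sum_congr rfl fun d _ => by rw [← hs]; congr 1; ring

theorem windowEnergy_eq_sum_add {N : ℕ} {s : ℕ → ℝ} (hs : ∀ j, s (j + N) = -s j) (p : ℕ) :
    windowEnergy N s = ∑ j ∈ Finset.range N, windowSum N s (j + p) ^ 2 :=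
  (sum_range_add_of_periodic (f := fun j => windowSum N s j ^ 2)
    (fun j => by rw [windowSum_add_period hs, neg_sq]) p).symm

/-- Parallelogram law: consecutive window sums differ by exactly `2` in absolute value, so each
midpoint loses `1`. -/
theorem sum_sq_mean_windowSum {N : ℕ} {s : ℕ → ℝ} (hs : ∀ j, s (j + N) = -s j)
    (hs1 : ∀ j, s j ^ 2 = 1) :
    ∑ j ∈ Finset.range N, ((windowSum N s (j + 1) + windowSum N s j) / 2) ^ 2
      = windowEnergy N s - N := by
  have h : ∀ j, ((windowSum N s (j + 1) + windowSum N s j) / 2) ^ 2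
      = (windowSum N s (j + 1) ^ 2 + windowSum N s j ^ 2) / 2 - 1 := fun j => by
    have h1 := windowSum_succ_sub hs j
    have h2 := hs1 j
    rw [eq_add_of_sub_eq h1]
    linear_combination -h2
  simp only [h]
  rw [Finset.sum_sub_distrib, ← Finset.sum_div, Finset.sum_add_distrib,
    ← windowEnergy_eq_sum_add hs 1, ← windowEnergy]
  simp

/-- The cubic `h ^ 3 / 3 - a ^ 2 * h`, made constant outside of `[-a, a]`. -/
noncomputable def clampedCubic (a h : ℝ) : ℝ :=
  max (-a) (min a h) ^ 3 / 3 - a ^ 2 * max (-a) (min a h)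

theorem abs_clampedCubic_le {a : ℝ} (ha : 0 ≤ a) (h : ℝ) : |clampedCubic a h| ≤ 2 * a ^ 3 / 3 := by
  have h1 : -a ≤ max (-a) (min a h) := le_max_left _ _
  have h2 : max (-a) (min a h) ≤ a := max_le (by linarith) (min_le_left _ _)
  unfold clampedCubic
  generalize max (-a) (min a h) = c at h1 h2
  rw [abs_le]
  constructor
  · nlinarith [mul_nonneg (sq_nonneg (c - a)) (by linarith : 0 ≤ c + 2 * a)]
  · nlinarith [mul_nonneg (sq_nonneg (c + a)) (by linarith : 0 ≤ 2 * a - c)]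

theorem clampedCubic_neg {a : ℝ} (ha : 0 ≤ a) (h : ℝ) :
    clampedCubic a (-h) = -clampedCubic a h := by
  have : max (-a) (min a (-h)) = -max (-a) (min a h) := by
    rw [← min_neg_neg, neg_neg, ← max_neg_neg, max_min_distrib_left,
      max_eq_right (by linarith : -a ≤ a)]
  rw [clampedCubic, clampedCubic, this]
  ring

/-- Clamping replaces the derivative `h² - a²` by `min (h² - a²) 0`, so the cubic minus its clamped
version is monotone. -/
theorem clampedCubic_sub_le {a : ℝ} (ha : 0 ≤ a) {x y : ℝ} (hxy : x ≤ y) :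
    clampedCubic a y - clampedCubic a x ≤ (y ^ 3 / 3 - a ^ 2 * y) - (x ^ 3 / 3 - a ^ 2 * x) := by
  have hm : Monotone fun h : ℝ => h ^ 3 / 3 - a ^ 2 * h - clampedCubic a h := by
    have h1 : MonotoneOn (fun h : ℝ => h ^ 3 / 3 - a ^ 2 * h - clampedCubic a h) (Set.Iic (-a)) := by
      intro x hx y hy hxy
      simp only [Set.mem_Iic] at hx hy
      simp only [clampedCubic, min_eq_right (by linarith : x ≤ a), min_eq_right (by linarith : y ≤ a),
        max_eq_left hx, max_eq_left hy]
      nlinarith [mul_nonneg (sub_nonneg.2 hxy) (by nlinarith : 0 ≤ y ^ 2 + x * y + x ^ 2 - 3 * a ^ 2)]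
    have h2 : MonotoneOn (fun h : ℝ => h ^ 3 / 3 - a ^ 2 * h - clampedCubic a h)
        (Set.Icc (-a) a) := by
      intro x hx y hy hxy
      simp only [clampedCubic, min_eq_right hx.2, min_eq_right hy.2, max_eq_right hx.1,
        max_eq_right hy.1, sub_self, le_refl]
    have h3 : MonotoneOn (fun h : ℝ => h ^ 3 / 3 - a ^ 2 * h - clampedCubic a h) (Set.Ici a) := by
      intro x hx y hy hxy
      simp only [Set.mem_Ici] at hx hy
      simp only [clampedCubic, min_eq_left hx, min_eq_left hy]
      nlinarith [mul_nonneg (sub_nonneg.2 hxy) (by nlinarith : 0 ≤ y ^ 2 + x * y + x ^ 2 - 3 * a ^ 2)]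
    have haa : -a ≤ a := by linarith
    have h4 := h1.union_right h2 isGreatest_Iic (isLeast_Icc haa)
    rw [Set.Iic_union_Icc_eq_Iic haa] at h4
    exact h4.Iic_union_Ici h3
  have := hm hxy
  simp only at this
  linarith

/-- A lower bound for the energy of an antiperiodic sequence of signs with `m` sign changes. -/
theorem windowEnergy_ge {N : ℕ} {s : ℕ → ℝ} (hs : ∀ j, s (j + N) = -s j)
    (hs1 : ∀ j, s j ^ 2 = 1) {m : ℝ} (hm : 0 < m)
    (hc : ∑ j ∈ Finset.range N, (1 - s j * s (j + 1)) / 2 = m) :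
    2 * N / 3 + N ^ 3 / (3 * m ^ 2) ≤ windowEnergy N s := by
  -- This value maximises `N a² - 2 a³ m / 3`, the bound that results for general `a`.
  set a : ℝ := N / m with ha_def
  have ha : 0 ≤ a := by positivity
  set H := windowSum N s with hH
  set P := clampedCubic a with hP
  have sgn : ∀ j, s j = 1 ∨ s j = -1 := fun j => mul_self_eq_one_iff.1 (by rw [← sq, hs1])
  -- The left side is the average slope of `P` between `H j` and `H (j + 1)`, at most the average of
  -- `h² - a²` there; `2/3` is the trapezoidal error for `h²` on an interval of length `2`.
  have edge : ∀ j, -s j * (P (H (j + 1)) - P (H j)) / 2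
      ≤ (H (j + 1) ^ 2 + H j ^ 2) / 2 - 2 / 3 - a ^ 2 := fun j => by
    have h1 : H (j + 1) = H j + -2 * s j := eq_add_of_sub_eq' (windowSum_succ_sub hs j)
    rcases sgn j with h | h <;> rw [h] at h1 ⊢
    · have := clampedCubic_sub_le ha (x := H (j + 1)) (y := H j) (by linarith)
      rw [h1] at this ⊢
      linarith
    · have := clampedCubic_sub_le ha (x := H j) (y := H (j + 1)) (by linarith)
      rw [h1] at this ⊢
      linarith
  -- After summation by parts only sign changes contribute, each at least `-max |P|`.
  have turn : ∀ j, -(2 * a ^ 3 / 3) * ((1 - s j * s (j + 1)) / 2)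
      ≤ (-s j * P (H (j + 1)) - -s (j + 1) * P (H (j + 1))) / 2 := fun j => by
    have hp := abs_le.1 (abs_clampedCubic_le ha (H (j + 1)))
    rcases sgn j with h | h <;>
      rcases sgn (j + 1) with h' | h' <;> rw [h, h'] <;>
      linarith
  have h1 := Finset.sum_le_sum fun j (_ : j ∈ Finset.range N) => edge j
  have h2 := Finset.sum_le_sum fun j (_ : j ∈ Finset.range N) => turn j
  -- `P` is odd and `s`, `H` are antiperiodic, so the product is periodic and leaves no boundary
  -- term.
  have h3 : ∑ j ∈ Finset.range N, -s (j + 1) * P (H (j + 1)) = ∑ j ∈ Finset.range N, -s j * P (H j) :=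
    sum_range_add_of_periodic (f := fun j => -s j * P (H j)) (fun j => by
      rw [hs, hH, windowSum_add_period hs, hP, clampedCubic_neg ha]; ring) 1
  rw [← Finset.mul_sum, hc, ← Finset.sum_div, Finset.sum_sub_distrib, h3, ← Finset.sum_sub_distrib]
    at h2
  simp only [← mul_sub] at h2
  rw [← Finset.sum_div, Finset.sum_sub_distrib, Finset.sum_sub_distrib, ← Finset.sum_div,
    Finset.sum_add_distrib, ← windowEnergy_eq_sum_add hs 1, ← windowEnergy] at h1
  simp only [Finset.sum_const, Finset.card_range, nsmul_eq_mul] at h1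
  have h4 : (N : ℝ) * a ^ 2 - 2 * a ^ 3 / 3 * m = N ^ 3 / (3 * m ^ 2) := by
    rw [ha_def]; field_simp; ring
  linarith

/-! ### Configurations as sequences of signs -/

/-- `-1` at the processors that hold a token, `1` at the others. -/
def tokenSign {N : ℕ} (A : Finset (Fin N)) (i : Fin N) : ℝ := if i ∈ A then -1 else 1

/-- The sign of the parity of the number of tokens met from `0` to `j - 1` around the ring. -/
def paritySign {N : ℕ} [NeZero N] (A : Finset (Fin N)) (j : ℕ) : ℝ :=
  ∏ i ∈ Finset.range j, tokenSign A (Fin.ofNat N i)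

theorem tokenSign_sq {N : ℕ} (A : Finset (Fin N)) (i : Fin N) : tokenSign A i ^ 2 = 1 := by
  unfold tokenSign; split_ifs <;> norm_num

theorem paritySign_succ {N : ℕ} [NeZero N] (A : Finset (Fin N)) (j : ℕ) :
    paritySign A (j + 1) = paritySign A j * tokenSign A (Fin.ofNat N j) :=
  Finset.prod_range_succ _ _

theorem paritySign_sq {N : ℕ} [NeZero N] (A : Finset (Fin N)) (j : ℕ) :
    paritySign A j ^ 2 = 1 := by
  rw [paritySign, ← Finset.prod_pow]
  exact Finset.prod_eq_one fun i _ => tokenSign_sq A _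

theorem Fin.ofNat_add_self {N : ℕ} [NeZero N] (j : ℕ) : Fin.ofNat N (j + N) = Fin.ofNat N j := by
  ext; simp

theorem Fin.ofNat_succ_eq_add_one {N : ℕ} [NeZero N] (j : ℕ) :
    Fin.ofNat N (j + 1) = Fin.ofNat N j + 1 := by
  ext; simp [Fin.val_add]

theorem Fin.ofNat_add_inj {N : ℕ} [NeZero N] {j d e : ℕ} (hd : d < N) (he : e < N)
    (h : Fin.ofNat N (j + d) = Fin.ofNat N (j + e)) : d = e := by
  have h' : (j + d) ≡ (j + e) [MOD N] := by
    simpa [Nat.ModEq] using congrArg Fin.val h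
  exact (Nat.ModEq.add_left_cancel' j h').eq_of_lt_of_lt hd he

theorem Fin.sum_range_ofNat {N : ℕ} [NeZero N] (f : Fin N → ℝ) :
    ∑ j ∈ Finset.range N, f (Fin.ofNat N j) = ∑ i, f i := by
  rw [Finset.sum_range]
  exact Finset.sum_congr rfl fun i _ => by congr 1; ext; simp

theorem paritySign_period {N : ℕ} [NeZero N] (A : Finset (Fin N)) :
    paritySign A N = (-1) ^ A.card := by
  have h : paritySign A N = ∏ i : Fin N, tokenSign A i := by
    rw [paritySign, Finset.prod_range]
    exact Finset.prod_congr rfl fun i _ => by congr 1; ext; simp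
  rw [h]
  unfold tokenSign
  rw [Finset.prod_ite]
  simp

theorem paritySign_add_period {N : ℕ} [NeZero N] {A : Finset (Fin N)} (hA : Odd A.card) (j : ℕ) :
    paritySign A (j + N) = -paritySign A j := by
  induction j with
  | zero => rw [zero_add, paritySign_period, hA.neg_one_pow]; simp [paritySign]
  | succ j ih =>
    rw [add_right_comm, paritySign_succ, ih, paritySign_succ, Fin.ofNat_add_self, neg_mul]

theorem sum_paritySign_changes {N : ℕ} [NeZero N] (A : Finset (Fin N)) :
    ∑ j ∈ Finset.range N, (1 - paritySign A j * paritySign A (j + 1)) / 2 = A.card := by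
  have h : ∀ j, (1 - paritySign A j * paritySign A (j + 1)) / 2
      = (fun i => if i ∈ A then (1 : ℝ) else 0) (Fin.ofNat N j) := fun j => by
    rw [paritySign_succ, ← mul_assoc, ← sq, paritySign_sq, tokenSign]
    simp only
    split_ifs <;> norm_num
  simp only [h]
  rw [Fin.sum_range_ofNat (fun i => if i ∈ A then (1 : ℝ) else 0)]
  simp

/-! ### One step of the algorithm -/

/-- `-1` for the coin that moves a token, `1` for the coin that keeps it. -/
def coinSign (b : Bool) : ℝ := if b then -1 else 1

theorem mem_hermanStep {N : ℕ} [NeZero N] (c : Fin N → Bool) (A : Finset (Fin N)) (i : Fin N) :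
    i + 1 ∈ hermanStep c A ↔ Xor (i + 1 ∈ A ∧ c (i + 1) = false) (i ∈ A ∧ c i = true) := by
  have h : (∃ a, (a ∈ A ∧ c a = true) ∧ a + 1 = i + 1) ↔ i ∈ A ∧ c i = true := by
    simp
  rw [hermanStep, Finset.mem_symmDiff]
  simp only [Finset.mem_filter, Finset.mem_image, h, Xor]

theorem tokenSign_hermanStep {N : ℕ} [NeZero N] (c : Fin N → Bool) (A : Finset (Fin N))
    (i : Fin N) :
    tokenSign (hermanStep c A) (i + 1)
      = (if c (i + 1) then 1 else tokenSign A (i + 1)) * (if c i then tokenSign A i else 1) := by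
  have h := mem_hermanStep c A i
  unfold tokenSign
  rw [if_congr h rfl rfl]
  by_cases h1 : i + 1 ∈ A <;> by_cases h2 : i ∈ A <;> cases h3 : c (i + 1) <;> cases h4 : c i <;>
    simp [h1, h2, Xor]

/-- Up to a global sign, a step replaces each sign either by itself or by the preceding one. -/
theorem paritySign_hermanStep {N : ℕ} [NeZero N] (c : Fin N → Bool) (A : Finset (Fin N)) :
    ∃ u : ℝ, u ^ 2 = 1 ∧ ∀ j, paritySign (hermanStep c A) (j + 1)
      = u * ((paritySign A (j + 1) + paritySign A j) / 2
        + coinSign (c (Fin.ofNat N j)) * ((paritySign A (j + 1) - paritySign A j) / 2)) := by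
  -- The global sign records whether the processor before `0` passes a token across the origin,
  -- where the parity count starts.
  obtain ⟨z, hz⟩ : ∃ z : Fin N, z + 1 = Fin.ofNat N 0 := ⟨Fin.ofNat N 0 - 1, sub_add_cancel _ _⟩
  have key : ∀ j, (paritySign A (j + 1) + paritySign A j) / 2
        + coinSign (c (Fin.ofNat N j)) * ((paritySign A (j + 1) - paritySign A j) / 2)
      = paritySign A j * (if c (Fin.ofNat N j) then 1 else tokenSign A (Fin.ofNat N j)) :=
    fun j => by
      rw [paritySign_succ, coinSign]
      split_ifs <;> ring
  refine ⟨if c z then tokenSign A z else 1, ?_, fun j => ?_⟩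
  · split_ifs
    · exact tokenSign_sq A z
    · norm_num
  rw [key]
  induction j with
  | zero =>
    rw [paritySign_succ, ← hz, tokenSign_hermanStep]
    simp only [paritySign, Finset.range_zero, Finset.prod_empty]
    ring
  | succ j ih =>
    rw [paritySign_succ, ih, Fin.ofNat_succ_eq_add_one, tokenSign_hermanStep, paritySign_succ]
    split_ifs <;> ring

theorem card_hermanStep {N : ℕ} [NeZero N] (c : Fin N → Bool) (A : Finset (Fin N)) :
    ∃ r, A.card = (hermanStep c A).card + 2 * r := by
  set B := A.filter fun i => c i = false
  set C := (A.filter fun i => c i = true).image fun i => i + 1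
  refine ⟨(B ∩ C).card, ?_⟩
  have h1 : A.card = B.card + C.card := by
    rw [Finset.card_image_of_injective _ (add_left_injective 1), add_comm,
      ← Finset.card_filter_add_card_filter_not (s := A) (fun i => c i = true)]
    simp [B]
  have h2 : (hermanStep c A).card = (B \ C).card + (C \ B).card :=
    Finset.card_union_of_disjoint disjoint_sdiff_sdiff
  have h3 := Finset.card_sdiff_add_card_inter B C
  have h4 := Finset.card_sdiff_add_card_inter C B
  rw [Finset.inter_comm] at h4
  omega

theorem odd_card_hermanStep {N : ℕ} [NeZero N] (c : Fin N → Bool) {A : Finset (Fin N)}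
    (hA : Odd A.card) : Odd (hermanStep c A).card := by
  obtain ⟨r, hr⟩ := card_hermanStep c A
  rw [hr] at hA
  exact (Nat.odd_add.1 hA).2 (even_two_mul r)

theorem card_hermanStep_le {N : ℕ} [NeZero N] (c : Fin N → Bool) (A : Finset (Fin N)) :
    (hermanStep c A).card ≤ A.card := by
  obtain ⟨r, hr⟩ := card_hermanStep c A
  omega

/-! ### Averaging over the coins of one step -/

/-- The mean of `f` over independent fair coins. -/
noncomputable def coinMean {N : ℕ} (f : (Fin N → Bool) → ℝ) : ℝ := (∑ c, f c) / 2 ^ N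

theorem coinMean_const {N : ℕ} (a : ℝ) : coinMean (fun _ : Fin N → Bool => a) = a := by
  simp [coinMean]

theorem coinMean_add {N : ℕ} (f g : (Fin N → Bool) → ℝ) :
    coinMean (fun c => f c + g c) = coinMean f + coinMean g := by
  simp [coinMean, Finset.sum_add_distrib, add_div]

theorem coinMean_mul_left {N : ℕ} (a : ℝ) (f : (Fin N → Bool) → ℝ) :
    coinMean (fun c => a * f c) = a * coinMean f := by
  simp [coinMean, ← Finset.mul_sum, mul_div_assoc]

theorem coinMean_sum {N : ℕ} {ι : Type*} (s : Finset ι) (f : ι → (Fin N → Bool) → ℝ) :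
    coinMean (fun c => ∑ i ∈ s, f i c) = ∑ i ∈ s, coinMean (f i) := by
  simp only [coinMean]
  rw [Finset.sum_comm, Finset.sum_div]

theorem coinMean_mono {N : ℕ} {f g : (Fin N → Bool) → ℝ} (h : ∀ c, f c ≤ g c) :
    coinMean f ≤ coinMean g := by
  unfold coinMean
  gcongr with c
  exact h c

theorem coinMean_eq_zero_of_flip {N : ℕ} {f : (Fin N → Bool) → ℝ} (i : Fin N)
    (h : ∀ c, f (Function.update c i (!c i)) = -f c) : coinMean f = 0 := by
  have hi : Function.Involutive fun c : Fin N → Bool => Function.update c i (!c i) := fun c => by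
    simp
  have h1 : ∑ c, f c = ∑ c, -f c := by
    rw [← Equiv.sum_comp (hi.toPerm _) f]
    exact Finset.sum_congr rfl fun c _ => h c
  rw [Finset.sum_neg_distrib] at h1
  rw [coinMean, show ∑ c, f c = 0 by linarith, zero_div]

theorem coinSign_not (b : Bool) : coinSign (!b) = -coinSign b := by
  cases b <;> simp [coinSign]

theorem coinMean_coinSign {N : ℕ} (i : Fin N) : coinMean (fun c => coinSign (c i)) = 0 :=
  coinMean_eq_zero_of_flip i fun c => by simp [coinSign_not]

theorem coinMean_coinSign_mul {N : ℕ} (i k : Fin N) :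
    coinMean (fun c => coinSign (c i) * coinSign (c k)) = if i = k then 1 else 0 := by
  split_ifs with h
  · subst h
    have : ∀ b, coinSign b * coinSign b = 1 := fun b => by cases b <;> simp [coinSign]
    simp only [this, coinMean_const]
  · exact coinMean_eq_zero_of_flip i fun c => by
      rw [Function.update_self, Function.update_of_ne (Ne.symm h), coinSign_not, neg_mul]

/-- Squared mean plus variance: a window of length `N` meets each processor once, so its coins are
uncorrelated. -/
theorem coinMean_sq_sum_window {N : ℕ} [NeZero N] (j : ℕ) (a b : ℕ → ℝ) :
    coinMean (fun c : Fin N → Bool =>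
        (∑ d ∈ Finset.range N, (a d + coinSign (c (Fin.ofNat N (j + d))) * b d)) ^ 2)
      = (∑ d ∈ Finset.range N, a d) ^ 2 + ∑ d ∈ Finset.range N, b d ^ 2 := by
  have h : ∀ c : Fin N → Bool,
      (∑ d ∈ Finset.range N, (a d + coinSign (c (Fin.ofNat N (j + d))) * b d)) ^ 2
        = (∑ d ∈ Finset.range N, a d) ^ 2
          + (∑ d ∈ Finset.range N, (2 * (∑ d ∈ Finset.range N, a d) * b d)
              * coinSign (c (Fin.ofNat N (j + d)))
          + ∑ d ∈ Finset.range N, ∑ e ∈ Finset.range N, (b d * b e)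
              * (coinSign (c (Fin.ofNat N (j + d))) * coinSign (c (Fin.ofNat N (j + e))))) :=
    fun c => by
      rw [Finset.sum_add_distrib, add_sq, add_assoc]
      congr 2
      · rw [Finset.mul_sum]
        exact Finset.sum_congr rfl fun d _ => by ring
      · rw [sq, Finset.sum_mul_sum]
        exact Finset.sum_congr rfl fun d _ => Finset.sum_congr rfl fun e _ => by ring
  simp only [h, coinMean_add, coinMean_const, coinMean_sum, coinMean_mul_left, coinMean_coinSign,
    coinMean_coinSign_mul, mul_zero, Finset.sum_const_zero, zero_add]
  congr 1
  refine Finset.sum_congr rfl fun d hd => ?_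
  rw [Finset.sum_eq_single d]
  · simp [sq]
  · intro e he hed
    rw [if_neg, mul_zero]
    exact fun h => hed (Fin.ofNat_add_inj (Finset.mem_range.1 hd) (Finset.mem_range.1 he) h).symm
  · exact fun h => absurd hd h

/-- The mean change of the energy in one step. -/
theorem coinMean_windowEnergy_hermanStep {N : ℕ} [NeZero N] {A : Finset (Fin N)}
    (hA : Odd A.card) :
    coinMean (fun c => windowEnergy N (paritySign (hermanStep c A)))
      = windowEnergy N (paritySign A) + N * (A.card - 1) := by
  set s := paritySign A with hs_def
  have hs : ∀ j, s (j + N) = -s j := paritySign_add_period hA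
  have hs1 : ∀ j, s j ^ 2 = 1 := paritySign_sq A
  have h : ∀ c, windowEnergy N (paritySign (hermanStep c A))
      = ∑ j ∈ Finset.range N, (∑ d ∈ Finset.range N, ((s (j + d + 1) + s (j + d)) / 2
        + coinSign (c (Fin.ofNat N (j + d))) * ((s (j + d + 1) - s (j + d)) / 2))) ^ 2 := fun c => by
    rw [windowEnergy_eq_sum_add (paritySign_add_period (odd_card_hermanStep c hA)) 1]
    refine Finset.sum_congr rfl fun j _ => ?_
    obtain ⟨u, hu, h⟩ := paritySign_hermanStep c A
    simp only [windowSum, add_right_comm j 1, h, ← Finset.mul_sum]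
    rw [mul_pow, hu, one_mul]
  simp only [h, coinMean_sum]
  simp only [coinMean_sq_sum_window _ (fun d => (s (_ + d + 1) + s (_ + d)) / 2)
    (fun d => (s (_ + d + 1) - s (_ + d)) / 2)]
  have h1 : ∀ j, ∑ d ∈ Finset.range N, (s (j + d + 1) + s (j + d)) / 2
      = (windowSum N s (j + 1) + windowSum N s j) / 2 := fun j => by
    rw [← Finset.sum_div, Finset.sum_add_distrib]
    simp only [windowSum, add_right_comm j 1]
  -- The variance counts the sign changes in one full period, one per token, wherever the window
  -- starts.
  have h2 : ∀ j, ∑ d ∈ Finset.range N, ((s (j + d + 1) - s (j + d)) / 2) ^ 2 = (A.card : ℝ) :=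
    fun j => by
    rw [← sum_paritySign_changes A,
      ← sum_range_add_of_periodic (f := fun j => (1 - paritySign A j * paritySign A (j + 1)) / 2) _ j]
    · refine Finset.sum_congr rfl fun d _ => ?_
      rw [← hs_def, add_comm d j]
      linear_combination (1 / 4 : ℝ) * hs1 (j + d + 1) + (1 / 4 : ℝ) * hs1 (j + d)
    · intro j
      rw [← hs_def, hs, add_right_comm, hs, neg_mul_neg]
  simp only [h1, h2]
  rw [Finset.sum_add_distrib, sum_sq_mean_windowSum hs hs1]
  simp only [Finset.sum_const, Finset.card_range, nsmul_eq_mul]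
  ring

/-! ### The potential function -/

theorem sum_sq_sub_two_mul (x : ℝ) (n : ℕ) :
    ∑ i ∈ Finset.range n, (x - 2 * i) ^ 2
      = n * x ^ 2 - 2 * x * (n * (n - 1)) + 2 * (n * (n - 1) * (2 * n - 1)) / 3 := by
  induction n with
  | zero => simp
  | succ n ih => rw [Finset.sum_range_succ, ih]; push_cast; ring

/-- Along a constant run of length `N` the window sums descend linearly: `u N`, `u (N - 2)`, `u (N -
4)`, and so on. -/
theorem windowEnergy_of_const {N : ℕ} {s : ℕ → ℝ} (hs : ∀ j, s (j + N) = -s j) {u : ℝ}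
    (hu : u ^ 2 = 1) (p : ℕ) (hp : ∀ i < N, s (p + i) = u) :
    windowEnergy N s = N * (N ^ 2 + 2) / 3 := by
  have h : ∀ i ≤ N, windowSum N s (i + p) = u * (N - 2 * i) := by
    intro i
    induction i with
    | zero =>
      intro _
      rw [zero_add, windowSum, Finset.sum_congr rfl fun d hd => hp d (Finset.mem_range.1 hd)]
      simp [mul_comm]
    | succ i ih =>
      intro hi
      have h1 := windowSum_succ_sub hs (i + p)
      rw [ih (by omega), add_comm i p, hp i (by omega), add_comm p i] at h1
      rw [add_right_comm]
      push_cast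
      linarith
  have h' : windowEnergy N s = ∑ i ∈ Finset.range N, ((N : ℝ) - 2 * i) ^ 2 := by
    rw [windowEnergy_eq_sum_add hs p]
    exact Finset.sum_congr rfl fun i hi => by
      rw [h i (Finset.mem_range.1 hi).le, mul_pow, hu, one_mul]
  rw [h', sum_sq_sub_two_mul]
  ring

theorem windowEnergy_of_card_eq_one {N : ℕ} [NeZero N] {A : Finset (Fin N)} (hA : A.card = 1) :
    windowEnergy N (paritySign A) = N * (N ^ 2 + 2) / 3 := by
  obtain ⟨p, rfl⟩ := Finset.card_eq_one.1 hA
  refine windowEnergy_of_const (paritySign_add_period (by simp))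
    (paritySign_sq {p} ((p : ℕ) + 1)) (p + 1) fun i => ?_
  induction i with
  | zero => simp
  | succ i ih =>
    intro hi
    rw [← add_assoc, paritySign_succ, ih (by omega), tokenSign, if_neg, mul_one]
    rw [Finset.mem_singleton]
    intro h
    have h0 : Fin.ofNat N ((p : ℕ) + 0) = p := by ext; simp
    have := Fin.ofNat_add_inj (j := (p : ℕ)) (d := i + 1) (e := 0) hi (by omega)
      (by rw [h0, add_comm i 1, ← add_assoc, h])
    omega

/-- A potential that decreases in each step, on average, by half of the number of excess tokens. -/
noncomputable def excessPotential {N : ℕ} [NeZero N] (A : Finset (Fin N)) : ℝ :=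
  ((N : ℝ) ^ 2 + 2) / 6 - windowEnergy N (paritySign A) / (2 * N)

/-- The largest value of `excessPotential` for `2 * k + 1` tokens. -/
noncomputable def excessBound (N k : ℕ) : ℝ := (N : ℝ) ^ 2 / 6 * (1 - 1 / (2 * k + 1) ^ 2)

theorem excessPotential_of_card_eq_one {N : ℕ} [NeZero N] {A : Finset (Fin N)}
    (hA : A.card = 1) : excessPotential A = 0 := by
  have hN : (N : ℝ) ≠ 0 := Nat.cast_ne_zero.2 (NeZero.ne N)
  rw [excessPotential, windowEnergy_of_card_eq_one hA]
  field_simp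
  ring

theorem excessPotential_le {N : ℕ} [NeZero N] {A : Finset (Fin N)} {k : ℕ}
    (hA : A.card = 2 * k + 1) : excessPotential A ≤ excessBound N k := by
  have hN : (0 : ℝ) < N := Nat.cast_pos.2 (NeZero.pos N)
  have hm : (A.card : ℝ) = 2 * k + 1 := by exact_mod_cast hA
  have h := windowEnergy_ge (paritySign_add_period (A := A) ⟨k, hA⟩) (paritySign_sq A)
    (by positivity : (0 : ℝ) < 2 * k + 1) (by rw [sum_paritySign_changes, hm])
  have h' : (2 * N / 3 + (N : ℝ) ^ 3 / (3 * (2 * k + 1) ^ 2)) / (2 * N)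
      ≤ windowEnergy N (paritySign A) / (2 * N) := by gcongr
  have e : ((N : ℝ) ^ 2 + 2) / 6 - (2 * N / 3 + (N : ℝ) ^ 3 / (3 * (2 * k + 1) ^ 2)) / (2 * N)
      = excessBound N k := by
    rw [excessBound]; field_simp; ring
  rw [excessPotential]
  linarith

theorem coinMean_excessPotential {N : ℕ} [NeZero N] {A : Finset (Fin N)} {k : ℕ}
    (hA : A.card = 2 * k + 1) :
    coinMean (fun c => excessPotential (hermanStep c A)) = excessPotential A - k := by
  have hN : (N : ℝ) ≠ 0 := Nat.cast_ne_zero.2 (NeZero.ne N)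
  have h : ∀ c, excessPotential (hermanStep c A) = ((N : ℝ) ^ 2 + 2) / 6
      + (-(1 / (2 * N))) * windowEnergy N (paritySign (hermanStep c A)) := fun c => by
    rw [excessPotential]; ring
  simp only [h]
  rw [coinMean_add, coinMean_const, coinMean_mul_left, coinMean_windowEnergy_hermanStep ⟨k, hA⟩,
    excessPotential, hA]
  push_cast
  field_simp
  ring

/-- Minimum principle: at a minimiser the mean cannot decrease, which forces `k = 0`, where the
potential vanishes. -/
theorem excessPotential_nonneg {N : ℕ} [NeZero N] {A : Finset (Fin N)} (hA : Odd A.card) :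
    0 ≤ excessPotential A := by
  have : Nonempty {B : Finset (Fin N) // Odd B.card} := ⟨⟨A, hA⟩⟩
  obtain ⟨⟨B, hB⟩, hmin⟩ :=
    Finite.exists_min fun B : {B : Finset (Fin N) // Odd B.card} => excessPotential B.1
  obtain ⟨k, hk⟩ := hB
  have h := coinMean_mono fun c => hmin ⟨hermanStep c B, odd_card_hermanStep c ⟨k, hk⟩⟩
  simp only [coinMean_const, coinMean_excessPotential hk] at h
  have hk0 : k = 0 := by
    have h0 : (k : ℝ) ≤ 0 := by linarith
    exact_mod_cast h0.antisymm k.cast_nonneg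
  rw [← excessPotential_of_card_eq_one (A := B) (by omega)]
  exact hmin ⟨A, hA⟩

/-! ### The bound on the expected time -/

/-- A bound for the mean time to stabilisation from `A`. -/
noncomputable def timePotential {N : ℕ} [NeZero N] (A : Finset (Fin N)) : ℝ :=
  excessPotential A / (A.card / 2 : ℕ)
    + ∑ i ∈ Finset.range (A.card / 2), excessBound N i / (i * (i + 1))

theorem timePotential_of_card {N : ℕ} [NeZero N] {A : Finset (Fin N)} {k : ℕ}
    (hA : A.card = 2 * k + 1) :
    timePotential A
      = excessPotential A / k + ∑ i ∈ Finset.range k, excessBound N i / (i * (i + 1)) := by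
  rw [timePotential, show A.card / 2 = k by omega]

theorem excessBound_mono (N : ℕ) : Monotone (excessBound N) := fun i j hij => by
  unfold excessBound
  gcongr

theorem excessBound_nonneg (N k : ℕ) : 0 ≤ excessBound N k := by
  have h : excessBound N 0 = 0 := by simp [excessBound]
  exact h ▸ excessBound_mono N (Nat.zero_le k)

/-- Raising `i` to `i + 1` lowers `v / i` by `v / (i (i + 1))`, which the new summand covers since
`v ≤ B k' ≤ B i`. This allows the weight `1/k` from before a step to be kept after tokens are lost.
-/
theorem div_add_sum_excessBound_mono {N k' k : ℕ} {v : ℝ} (hv : v ≤ excessBound N k')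
    (hv0 : k' = 0 → v = 0) (hk : k' ≤ k) :
    v / k' + ∑ i ∈ Finset.range k', excessBound N i / (i * (i + 1))
      ≤ v / k + ∑ i ∈ Finset.range k, excessBound N i / (i * (i + 1)) := by
  induction k, hk using Nat.le_induction with
  | base => exact le_rfl
  | succ k hk ih =>
    refine ih.trans ?_
    rw [Finset.sum_range_succ]
    -- At `k = 0` the quotients by zero are `0` by convention, and `v = 0`.
    rcases Nat.eq_zero_or_pos k with rfl | hk0
    · simp [hv0 (by omega)]
    · have hk1 : (0 : ℝ) < k := Nat.cast_pos.2 hk0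
      have h1 : v / k - v / (k + 1 : ℕ) = v / (k * (k + 1)) := by
        push_cast; field_simp; ring
      have h2 : v / (k * (k + 1)) ≤ excessBound N k / (k * (k + 1)) := by
        gcongr
        exact hv.trans (excessBound_mono N hk)
      linarith

theorem coinMean_timePotential_le {N : ℕ} [NeZero N] {A : Finset (Fin N)} (hA : Odd A.card)
    (hA1 : A.card ≠ 1) :
    coinMean (fun c => timePotential (hermanStep c A)) ≤ timePotential A - 1 := by
  obtain ⟨k, hk⟩ := hA
  have hk0 : (k : ℝ) ≠ 0 := Nat.cast_ne_zero.2 (by omega)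
  have h : ∀ c, timePotential (hermanStep c A) ≤ 1 / k * excessPotential (hermanStep c A)
      + ∑ i ∈ Finset.range k, excessBound N i / (i * (i + 1)) := fun c => by
    obtain ⟨k', hk'⟩ := odd_card_hermanStep c ⟨k, hk⟩
    have hle := card_hermanStep_le c A
    rw [timePotential_of_card hk', one_div_mul_eq_div]
    exact div_add_sum_excessBound_mono (excessPotential_le hk')
      (fun h0 => excessPotential_of_card_eq_one (by omega)) (by omega)
  refine (coinMean_mono h).trans_eq ?_
  rw [coinMean_add, coinMean_mul_left, coinMean_const, coinMean_excessPotential hk,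
    timePotential_of_card hk]
  field_simp
  ring

theorem timePotential_nonneg {N : ℕ} [NeZero N] {A : Finset (Fin N)} (hA : Odd A.card) :
    0 ≤ timePotential A :=
  add_nonneg (div_nonneg (excessPotential_nonneg hA) (Nat.cast_nonneg _))
    (Finset.sum_nonneg fun i _ => div_nonneg (excessBound_nonneg N i) (by positivity))

theorem hasSum_one_div_odd_sq :
    HasSum (fun n : ℕ => 1 / (2 * (n : ℝ) + 1) ^ 2) (Real.pi ^ 2 / 8) := by
  have h0 : HasSum (fun n : ℕ => (1 : ℝ) / ((2 * n : ℕ) : ℝ) ^ 2) (Real.pi ^ 2 / 24) := by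
    have e : (fun n : ℕ => (1 : ℝ) / ((2 * n : ℕ) : ℝ) ^ 2) = fun n : ℕ => 1 / 4 * (1 / (n : ℝ) ^ 2) :=
      funext fun n => by
        push_cast
        rw [mul_pow, one_div_mul_one_div]
        norm_num
    rw [e, show Real.pi ^ 2 / 24 = 1 / 4 * (Real.pi ^ 2 / 6) by ring]
    exact hasSum_zeta_two.mul_left _
  have h1 : Summable fun n : ℕ => (1 : ℝ) / ((2 * n + 1 : ℕ) : ℝ) ^ 2 :=
    hasSum_zeta_two.summable.comp_injective (i := fun n : ℕ => 2 * n + 1) fun a b h => by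
      simpa using h
  have h2 : Real.pi ^ 2 / 24 + ∑' n : ℕ, (1 : ℝ) / ((2 * n + 1 : ℕ) : ℝ) ^ 2 = Real.pi ^ 2 / 6 :=
    HasSum.unique (HasSum.even_add_odd (f := fun n : ℕ => (1 : ℝ) / (n : ℝ) ^ 2) h0 h1.hasSum)
      hasSum_zeta_two
  have h3 := h1.hasSum
  rw [show ∑' n : ℕ, (1 : ℝ) / ((2 * n + 1 : ℕ) : ℝ) ^ 2 = Real.pi ^ 2 / 8 by linarith] at h3
  simpa only [Nat.cast_add, Nat.cast_mul, Nat.cast_ofNat, Nat.cast_one] using h3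

/-- This rests on `1 - 1/(2i+1)² = 4 i (i + 1)/(2i+1)²`. The `-4` removes the term `i = 0`, which is
`0` on the left because its denominator vanishes. -/
theorem excessBound_div_add_sum (N k : ℕ) :
    excessBound N k / k + ∑ i ∈ Finset.range k, excessBound N i / (i * (i + 1))
      = (N : ℝ) ^ 2 / 6 * (4 * ∑ i ∈ Finset.range k, 1 / (2 * (i : ℝ) + 1) ^ 2
        - 4 + 2 / (2 * k + 1) + 2 / (2 * k + 1) ^ 2) := by
  induction k with
  | zero => simp; right; norm_num
  | succ k ih =>
    rw [Finset.sum_range_succ, Finset.sum_range_succ]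
    rcases Nat.eq_zero_or_pos k with rfl | hk
    · simp [excessBound]; left; norm_num
    · have hk1 : (k : ℝ) ≠ 0 := by positivity
      rw [eq_sub_of_add_eq' ih]
      unfold excessBound
      push_cast
      field_simp
      ring

theorem tail_sum_one_div_odd_sq (k : ℕ) :
    4 * ∑ i ∈ Finset.range k, 1 / (2 * (i : ℝ) + 1) ^ 2 + 2 / (2 * k + 1) + 2 / (2 * k + 1) ^ 2
      < Real.pi ^ 2 / 2 := by
  set f : ℕ → ℝ := fun k => 4 * ∑ i ∈ Finset.range k, 1 / (2 * (i : ℝ) + 1) ^ 2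
    + 2 / (2 * k + 1) + 2 / (2 * k + 1) ^ 2 with hf
  -- The remainder terms vanish in the limit, so strict growth puts every value strictly below `4 ·
  -- π²/8`.
  have hmono : StrictMono f := strictMono_nat_of_lt_succ fun k => by
    have h : f (k + 1) - f k = 8 / ((2 * k + 1) ^ 2 * (2 * k + 3) ^ 2) := by
      simp only [hf]
      rw [Finset.sum_range_succ]
      push_cast
      have h3 : (2 * ((k : ℝ) + 1) + 1) = 2 * k + 3 := by ring
      rw [h3]
      field_simp
      ring
    have h' : (0 : ℝ) < 8 / ((2 * k + 1) ^ 2 * (2 * k + 3) ^ 2) := by positivity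
    linarith
  have h0 : Filter.Tendsto (fun k : ℕ => 1 / (2 * (k : ℝ) + 1)) Filter.atTop (nhds 0) := by
    simp only [one_div]
    refine tendsto_inv_atTop_zero.comp (Filter.tendsto_atTop_add_const_right _ _ ?_)
    exact tendsto_natCast_atTop_atTop.const_mul_atTop (by norm_num)
  have hlim : Filter.Tendsto f Filter.atTop (nhds (Real.pi ^ 2 / 2)) := by
    have h := ((hasSum_one_div_odd_sq.tendsto_sum_nat.const_mul 4).add (h0.const_mul 2)).add
      ((h0.pow 2).const_mul 2)
    convert h using 2
    · simp [hf, div_eq_mul_inv]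
    · ring
  exact (hmono (Nat.lt_succ_self k)).trans_le (hmono.monotone.ge_of_tendsto hlim (k + 1))

theorem timePotential_lt {N : ℕ} [NeZero N] {A : Finset (Fin N)} (hA : Odd A.card) :
    timePotential A < (Real.pi ^ 2 - 8) * (N : ℝ) ^ 2 / 12 := by
  obtain ⟨k, hk⟩ := hA
  have hN : (0 : ℝ) < N := Nat.cast_pos.2 (NeZero.pos N)
  calc timePotential A
      ≤ excessBound N k / k + ∑ i ∈ Finset.range k, excessBound N i / (i * (i + 1)) := by
        rw [timePotential_of_card hk]
        gcongr
        exact excessPotential_le hk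
    _ < (N : ℝ) ^ 2 / 6 * (Real.pi ^ 2 / 2 - 4) := by
        rw [excessBound_div_add_sum]
        have := tail_sum_one_div_odd_sq k
        gcongr
        linarith
    _ = _ := by ring

/-! ### The law of the coins -/

/-- The law of the coins of one step. -/
noncomputable def stepCoins (N : ℕ) : Measure (Fin N → Bool) :=
  Measure.pi fun _ : Fin N => (PMF.uniformOfFintype Bool).toMeasure

instance isProbabilityMeasure_stepCoins (N : ℕ) : IsProbabilityMeasure (stepCoins N) := by
  unfold stepCoins; infer_instance

instance isProbabilityMeasure_hermanCoins (N : ℕ) : IsProbabilityMeasure (hermanCoins N) := by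
  unfold hermanCoins; infer_instance

/-- Prepend the coins of a first step. -/
def consCoins {N : ℕ} (p : (Fin N → Bool) × (ℕ → Fin N → Bool)) : ℕ → Fin N → Bool
  | 0 => p.1
  | t + 1 => p.2 t

theorem measurable_consCoins {N : ℕ} : Measurable (consCoins (N := N)) :=
  measurable_pi_lambda _ fun t => by
    cases t with
    | zero => exact measurable_fst
    | succ t => exact (measurable_pi_apply t).comp measurable_snd

/-- This is the Markov property at the first step, checked on boxes. -/
theorem map_consCoins (N : ℕ) :
    ((stepCoins N).prod (hermanCoins N)).map consCoins = hermanCoins N := by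
  refine Measure.eq_infinitePi _ fun s t ht => ?_
  have hmem : ∀ r : Set (Fin N → Bool), MeasurableSet r := fun r => r.toFinite.measurableSet
  classical
  -- Padding with `Set.univ` makes the index set an initial segment, so that time `0` splits off.
  set t' : ℕ → Set (Fin N → Bool) := fun i => if i ∈ s then t i else Set.univ with ht'
  obtain ⟨n, hsn⟩ : ∃ n, s ⊆ Finset.range (n + 1) := ⟨s.sup id, fun i hi => by
    have : i ≤ s.sup id := Finset.le_sup (f := id) hi
    exact Finset.mem_range.2 (by omega)⟩
  have h1 : Set.pi (s : Set ℕ) t = Set.pi (Finset.range (n + 1) : Set ℕ) t' := by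
    ext ω
    simp only [Set.mem_pi, ht', Finset.mem_coe]
    constructor
    · intro h i _
      split_ifs with hi
      · exact h i hi
      · trivial
    · intro h i hi
      simpa [hi] using h i (hsn hi)
  have h2 : ∏ i ∈ s, stepCoins N (t i) = ∏ i ∈ Finset.range (n + 1), stepCoins N (t' i) := by
    rw [← Finset.prod_subset hsn]
    · exact Finset.prod_congr rfl fun i hi => by simp [ht', hi]
    · intro i _ hi
      simp [ht', hi]
  have h3 : consCoins ⁻¹' Set.pi (Finset.range (n + 1) : Set ℕ) t'
      = t' 0 ×ˢ Set.pi (Finset.range n : Set ℕ) fun i => t' (i + 1) := by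
    ext ⟨c, ω⟩
    simp only [Set.mem_preimage, Set.mem_pi, Set.mem_prod, Finset.coe_range, Set.mem_Iio]
    constructor
    · exact fun h => ⟨h 0 (by omega), fun i hi => h (i + 1) (by omega)⟩
    · rintro ⟨h, h'⟩ (_ | i) hi
      · exact h
      · exact h' i (by omega)
  have h4 : hermanCoins N (Set.pi (Finset.range n : Set ℕ) fun i => t' (i + 1))
      = ∏ i ∈ Finset.range n, stepCoins N (t' (i + 1)) :=
    Measure.infinitePi_pi _ fun i _ => hmem _
  rw [Measure.map_apply measurable_consCoins (MeasurableSet.pi s.countable_toSet fun i _ => ht i),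
    h1, h3, Measure.prod_prod, h4, mul_comm]
  exact (Finset.prod_range_succ' (fun i => stepCoins N (t' i)) n).symm.trans h2.symm

theorem lintegral_stepCoins {N : ℕ} {f : (Fin N → Bool) → ℝ} (hf : ∀ c, 0 ≤ f c) :
    ∫⁻ c, ENNReal.ofReal (f c) ∂stepCoins N = ENNReal.ofReal (coinMean f) := by
  have h : ∀ c : Fin N → Bool, stepCoins N {c} = ENNReal.ofReal ((1 / 2) ^ N) := fun c => by
    have hb : ∀ b : Bool, (PMF.uniformOfFintype Bool).toMeasure {b} = ENNReal.ofReal (1 / 2) :=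
      fun b => by
        rw [PMF.toMeasure_apply_singleton _ _ (measurableSet_singleton b),
          PMF.uniformOfFintype_apply, Fintype.card_bool, one_div,
          ENNReal.ofReal_inv_of_pos (by norm_num)]
        norm_num
    rw [stepCoins, Measure.pi_singleton]
    simp only [hb, Finset.prod_const, Finset.card_univ, Fintype.card_fin]
    rw [ENNReal.ofReal_pow (by norm_num)]
  rw [lintegral_fintype, coinMean, Finset.sum_div,
    ENNReal.ofReal_sum_of_nonneg fun c _ => div_nonneg (hf c) (by positivity)]
  refine Finset.sum_congr rfl fun c _ => ?_
  rw [h, ← ENNReal.ofReal_mul (hf c)]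
  congr 1
  rw [one_div_pow, mul_one_div]

/-! ### The truncated time to stabilisation -/

/-- The time to stabilisation, stopped at time `n`. -/
def truncatedTime {N : ℕ} [NeZero N] : ℕ → Finset (Fin N) → (ℕ → Fin N → Bool) → ℕ
  | 0, _, _ => 0
  | n + 1, A, ω =>
    if A.card = 1 then 0 else truncatedTime n (hermanStep (ω 0) A) (fun t => ω (t + 1)) + 1

theorem truncatedTime_mono {N : ℕ} [NeZero N] (A : Finset (Fin N)) (ω : ℕ → Fin N → Bool) :
    Monotone fun n => truncatedTime n A ω := by
  refine monotone_nat_of_le_succ fun n => ?_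
  induction n generalizing A ω with
  | zero => exact Nat.zero_le _
  | succ n ih =>
    rw [truncatedTime, truncatedTime]
    split_ifs
    · exact le_rfl
    · exact Nat.succ_le_succ (ih _ _)

theorem hermanRun_succ {N : ℕ} [NeZero N] (A : Finset (Fin N)) (ω : ℕ → Fin N → Bool) (t : ℕ) :
    hermanRun A ω (t + 1) = hermanRun (hermanStep (ω 0) A) (fun t => ω (t + 1)) t := by
  induction t with
  | zero => rfl
  | succ t ih => rw [hermanRun, ih, hermanRun]

theorem le_truncatedTime {N : ℕ} [NeZero N] (A : Finset (Fin N)) (ω : ℕ → Fin N → Bool) (n : ℕ)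
    (h : ∀ t < n, (hermanRun A ω t).card ≠ 1) : n ≤ truncatedTime n A ω := by
  induction n generalizing A ω with
  | zero => exact Nat.zero_le _
  | succ n ih =>
    rw [truncatedTime, if_neg (show A.card ≠ 1 from h 0 n.succ_pos)]
    refine Nat.succ_le_succ (ih _ _ fun t ht => ?_)
    rw [← hermanRun_succ]
    exact h (t + 1) (Nat.succ_lt_succ ht)

/-- Only this inequality is needed for an upper bound; it also covers runs that never stabilise,
where the truncations are unbounded. -/
theorem stabilisationTime_le_iSup {N : ℕ} [NeZero N] (A : Finset (Fin N))
    (ω : ℕ → Fin N → Bool) :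
    (stabilisationTime A ω : ℝ≥0∞) ≤ ⨆ n, (truncatedTime n A ω : ℝ≥0∞) := by
  have key : ∀ n : ℕ, (n : ℕ∞) ≤ stabilisationTime A ω →
      (n : ℝ≥0∞) ≤ ⨆ n, (truncatedTime n A ω : ℝ≥0∞) := fun n hn => by
    refine le_trans ?_ (le_iSup (fun n => (truncatedTime n A ω : ℝ≥0∞)) n)
    refine Nat.cast_le.2 (le_truncatedTime A ω n fun t ht hcard => ?_)
    exact absurd (Nat.cast_le.1 (hn.trans (iInf₂_le t hcard))) (by omega)
  cases hT : stabilisationTime A ω using ENat.recTopCoe with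
  | top =>
    rw [hT] at key
    exact (ENNReal.eq_top_of_forall_nnreal_le fun r => by
      obtain ⟨n, hn⟩ := exists_nat_ge r
      exact le_trans (by exact_mod_cast hn) (key n le_top)).ge
  | coe n => exact_mod_cast key n hT.ge

theorem measurable_truncatedTime {N : ℕ} [NeZero N] (n : ℕ) (A : Finset (Fin N)) :
    Measurable (truncatedTime n A) := by
  induction n generalizing A with
  | zero => exact measurable_const
  | succ n ih =>
    by_cases hA : A.card = 1
    · have : truncatedTime (n + 1) A = fun _ => 0 := funext fun ω => by rw [truncatedTime, if_pos hA]
      rw [this]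
      exact measurable_const
    · have : truncatedTime (n + 1) A
          = (fun p : (Fin N → Bool) × (ℕ → Fin N → Bool) =>
              truncatedTime n (hermanStep p.1 A) p.2 + 1) ∘ fun ω => (ω 0, fun t => ω (t + 1)) :=
        funext fun ω => by rw [truncatedTime, if_neg hA]; rfl
      rw [this]
      have h : Measurable fun p : (Fin N → Bool) × (ℕ → Fin N → Bool) =>
          truncatedTime n (hermanStep p.1 A) p.2 + 1 :=
        measurable_from_prod_countable_right fun c => (ih (hermanStep c A)).add_const 1
      exact h.comp <| (measurable_pi_apply 0).prodMk
          (measurable_pi_lambda _ fun t => measurable_pi_apply (t + 1))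

/-- The mean of the truncated time to stabilisation. -/
noncomputable def meanTruncatedTime {N : ℕ} [NeZero N] : ℕ → Finset (Fin N) → ℝ
  | 0, _ => 0
  | n + 1, A =>
    if A.card = 1 then 0 else coinMean (fun c => meanTruncatedTime n (hermanStep c A)) + 1

theorem meanTruncatedTime_nonneg {N : ℕ} [NeZero N] (n : ℕ) (A : Finset (Fin N)) :
    0 ≤ meanTruncatedTime n A := by
  induction n generalizing A with
  | zero => exact le_rfl
  | succ n ih =>
    rw [meanTruncatedTime]
    split_ifs
    · exact le_rfl
    · have h := coinMean_mono (N := N) fun c => ih (hermanStep c A)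
      rw [coinMean_const] at h
      linarith

theorem lintegral_truncatedTime {N : ℕ} [NeZero N] (n : ℕ) (A : Finset (Fin N)) :
    ∫⁻ ω, (truncatedTime n A ω : ℝ≥0∞) ∂hermanCoins N
      = ENNReal.ofReal (meanTruncatedTime n A) := by
  induction n generalizing A with
  | zero => simp [truncatedTime, meanTruncatedTime]
  | succ n ih =>
    have hm : Measurable fun ω => (truncatedTime (n + 1) A ω : ℝ≥0∞) :=
      (measurable_from_nat).comp (measurable_truncatedTime (n + 1) A)
    rw [meanTruncatedTime]
    split_ifs with hA
    · simp [truncatedTime, hA]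
    · rw [← map_consCoins, lintegral_map hm measurable_consCoins,
        lintegral_prod (fun p => (truncatedTime (n + 1) A (consCoins p) : ℝ≥0∞))
          (hm.comp measurable_consCoins).aemeasurable]
      have h : ∀ c ω, (truncatedTime (n + 1) A (consCoins (c, ω)) : ℝ≥0∞)
          = truncatedTime n (hermanStep c A) ω + 1 := fun c ω => by
        rw [truncatedTime, if_neg hA]
        push_cast
        rfl
      simp only [h]
      have h' : ∀ c, ∫⁻ ω, ((truncatedTime n (hermanStep c A) ω : ℝ≥0∞) + 1) ∂hermanCoins N
          = ENNReal.ofReal (meanTruncatedTime n (hermanStep c A) + 1) := fun c => by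
        rw [lintegral_add_right _ measurable_const, ih, lintegral_const, measure_univ, mul_one,
          ENNReal.ofReal_add (meanTruncatedTime_nonneg _ _) zero_le_one, ENNReal.ofReal_one]
      simp only [h']
      rw [lintegral_stepCoins fun c => add_nonneg (meanTruncatedTime_nonneg _ _) zero_le_one,
        coinMean_add, coinMean_const]

/-- Induction on the horizon replaces optional stopping: each unstabilised step costs `1`, which the
mean drop of the potential pays, and the leftover is nonnegative. -/
theorem meanTruncatedTime_le {N : ℕ} [NeZero N] (n : ℕ) {A : Finset (Fin N)} (hA : Odd A.card) :
    meanTruncatedTime n A ≤ timePotential A := by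
  induction n generalizing A with
  | zero => exact timePotential_nonneg hA
  | succ n ih =>
    rw [meanTruncatedTime]
    split_ifs with hA1
    · exact timePotential_nonneg hA
    · have h := coinMean_mono fun c => ih (odd_card_hermanStep c hA)
      linarith [coinMean_timePotential_le hA hA1]

theorem mainTheorem1 (N : ℕ) [NeZero N] (A : Finset (Fin N)) (hA : Odd A.card) :
    expectedStabilisationTime A < ENNReal.ofReal ((Real.pi ^ 2 - 8) * (N : ℝ) ^ 2 / 12) := by
  calc expectedStabilisationTime A
      ≤ ∫⁻ ω, ⨆ n, (truncatedTime n A ω : ℝ≥0∞) ∂hermanCoins N :=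
        lintegral_mono fun ω => stabilisationTime_le_iSup A ω
    _ = ⨆ n, ∫⁻ ω, (truncatedTime n A ω : ℝ≥0∞) ∂hermanCoins N :=
        lintegral_iSup (fun n => measurable_from_nat.comp (measurable_truncatedTime n A))
          fun i j hij ω => Nat.cast_le.2 (truncatedTime_mono A ω hij)
    _ ≤ ENNReal.ofReal (timePotential A) := iSup_le fun n => by
        rw [lintegral_truncatedTime]
        exact ENNReal.ofReal_le_ofReal (meanTruncatedTime_le n hA)
    _ < _ := (ENNReal.ofReal_lt_ofReal_iff_of_nonneg (timePotential_nonneg hA)).2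
        (timePotential_lt hA)
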